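/- **Model.** There are $n$ nodes and $n$ messages; at time $0$ each message $i$ is given to at least one node (its sources). A packet is represented by its coefficient vector in $\mathbb{F}_2^n$. The active packets of a node are the unit vectors $e_i$ of the messages it is given at time $0$, which it keeps unchanged, together with $s$ stored packets, initially zero. In every round an adversary that knows the complete history chooses a probability distribution over ordered pairs $(u,v)$ of nodes and one pair is sampled. If $u\neq v$, then $u$ sends to $v$ one uniformly random vector $p$ of the span of its active packets, and $v$ updates its $s$ stored packets; if $u=v$, nothing happens. In the *accumulator* FM-RLNC protocol $v$ adds to each stored packet an independent uniformly random $\mathbb{F}_2$-multiple of $p$; in the *recombinator* FM-RLNC protocol $v$ replaces the stored packets by $s$ independent uniform samples from the span of its active packets and $p$. The messages have been *spread* when, at every node, the unit vectors of its initial messages and all packets it has received so far span $\mathbb{F}_2^n$. The cut of a node set $S$ in a round is the probability (under the distribution chosen for this round) that the sampled pair $(u,v)$ has $u\in S$ and $v\notin S$. For an integer $\Delta\ge 1$, the *min-average-cut* (with window length $\Delta$) is at least $C$ if, along every possible course of events, for every nonempty proper subset $S$ of the nodes and every $\Delta$ consecutive rounds, the average of the cuts of $S$ in these rounds is at least $C$.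 **Lemma.** (a) For every $\Delta\ge 1$ there are constants $K,c>0$, depending only on $\Delta$, such that for all $n\ge 1$, $a\ge 1$, $C>0$ with $C\ge n^{-a}$, and $s\ge c\,a\log n$: if the min-average-cut with window length $\Delta$ is at least $C$, then each of the two FM-RLNC protocols with binary coefficients ($q=2$) and $s$ stored packets has spread all $n$ messages after $T$ rounds with probability at least $1-2^{-n}$, for every integer $T\ge K\,n/C$. (b) This time is order optimal: for all $n\ge 2$ and $0<C\le 1/n$ there are a placement of the $n$ messages and a time-independent distribution over ordered pairs of nodes, with min-average-cut at least $C$ for every window length, such that for every $s$, every protocol (any rule, possibly randomized and using the complete current state of the network, for choosing the transmitted packet in $\mathbb{F}_2^n$ and the receiver's new stored packets) and every integer $0\le T\le n/(2C)$, the messages have been spread after $T$ rounds with probability at most $1/2$. -/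

import Mathlib

open scoped ENNReal

noncomputable section

namespace NetCoding

/-- The coefficient vector of a packet, a linear combination of `k` messages over `F`.
The payload of a packet is determined by its coefficient vector and is not modelled. -/
abbrev Packet (F : Type) (k : ℕ) : Type := Fin k → F

/-- The complete state of a network with node set `V`. Node `v` has the `s` packets `mem v` in its
active memory (an empty slot holds the zero packet), and `inbox v` lists all packets that it has
received so far, which it keeps for decoding only. -/
structure State (V F : Type) (k s : ℕ) where
  mem : V → Fin s → Packet F k
  inbox : V → List (Packet F k)

/-- The initial state: all memory slots are empty and nothing has been received. -/
def State.init (V F : Type) [Zero F] (k s : ℕ) : State V F k s where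
  mem := fun _ _ => 0
  inbox := fun _ => []

/-- The states after each of the rounds played so far, the most recent first. -/
abbrev History (V F : Type) (k s : ℕ) : Type := List (State V F k s)

/-- The current state at the end of a history. -/
def History.current {V F : Type} [Zero F] {k s : ℕ} (h : History V F k s) : State V F k s :=
  h.headD (State.init V F k s)

/-- A (fully adaptive) adversary chooses, given everything that has happened so far, a probability
distribution over ordered pairs of nodes. If `(u, v)` with `u ≠ v` is sampled, then one packet is
transferred from `u` to `v`; if a pair `(u, u)` is sampled, then nothing happens in this round. -/
abbrev Adversary (V F : Type) (k s : ℕ) : Type := History V F k s → PMF (V × V)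

/-- What happens when a packet is transferred from `u` to `v` in a given state: the joint law of the
packet that is sent by `u` and of the new content of the active memory of `v`. -/
abbrev Protocol (V F : Type) (k s : ℕ) : Type :=
  State V F k s → V → V → PMF (Packet F k × (Fin s → Packet F k))

section Model

variable {V F : Type} [DecidableEq V] [Field F] {k s : ℕ}

/-- One round of the asynchronous single transfer model: the law of the next state. -/
def step (P : Protocol V F k s) (A : Adversary V F k s) (h : History V F k s) :
    PMF (State V F k s) :=
  (A h).bind fun e =>
    if e.1 = e.2 then PMF.pure h.current
    else (P h.current e.1 e.2).map fun x =>
      { mem := Function.update h.current.mem e.2 x.2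
        inbox := Function.update h.current.inbox e.2 (x.1 :: h.current.inbox e.2) }

/-- The law of the history of the first `t` rounds. -/
def run (P : Protocol V F k s) (A : Adversary V F k s) : ℕ → PMF (History V F k s)
  | 0 => PMF.pure []
  | t + 1 => (run P A t).bind fun h => (step P A h).map fun σ => σ :: h

/-- The probability that the next transfer goes from a node in `S` to a node outside of `S`. -/
def cutWeight [Fintype V] (p : PMF (V × V)) (S : Finset V) : ℝ :=
  ∑ u ∈ S, ∑ v ∈ Sᶜ, (p (u, v)).toReal

/-- The min-average-cut with respect to windows of length `Δ` is at least `C`: along every possible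
course of events, for each nonempty proper subset `S` of the nodes separately, the average of the
cut weight of `S` over any `Δ` consecutive rounds is at least `C`. Here `h` is the history before
the last round of the window, and `h.drop j` is the history before the round `j` rounds earlier. -/
def MinAverageCutAtLeast [Fintype V] (P : Protocol V F k s) (A : Adversary V F k s)
    (Δ : ℕ) (C : ℝ) : Prop :=
  ∀ S : Finset V, S.Nonempty → S ≠ Finset.univ →
    ∀ t : ℕ, ∀ h ∈ (run P A (t + Δ - 1)).support,
      C ≤ (∑ j ∈ Finset.range Δ, cutWeight (A (h.drop j)) S) / Δ

/-- The packets (unit vectors) of the messages that node `v` knows initially, where `src i` is the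
set of nodes to which message `i` is given at time `0`. -/
def sourcePackets (src : Fin k → Set V) (v : V) : Set (Packet F k) :=
  {x | ∃ i, v ∈ src i ∧ x = Pi.single i 1}

/-- All nodes can decode: at each node the initial packets and the received packets together span
the full space. -/
def AllDecoded (src : Fin k → Set V) (σ : State V F k s) : Prop :=
  ∀ v, Submodule.span F (sourcePackets src v ∪ {x | x ∈ σ.inbox v}) = ⊤

/-- The probability that all nodes can decode all messages after `T` rounds. -/
def successProb (P : Protocol V F k s) (A : Adversary V F k s) (src : Fin k → Set V) (T : ℕ) :
    ℝ≥0∞ :=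
  (run P A T).toOuterMeasure {h | AllDecoded src h.current}

end Model

section FMRLNC

variable {V F : Type} [Field F] [Finite F] {k s : ℕ}

/-- The span of the active packets of `v`: the packets of its initial messages, which it keeps
unchanged, and the `s` packets in its active memory. -/
def activeSpan (src : Fin k → Set V) (σ : State V F k s) (v : V) : Submodule F (Packet F k) :=
  Submodule.span F (sourcePackets src v ∪ Set.range (σ.mem v))

/-- `m` independent uniformly random vectors of a subspace. -/
def uniformSamples (W : Submodule F (Packet F k)) (m : ℕ) : PMF (Fin m → Packet F k) :=
  letI : Fintype (Fin m → W) := Fintype.ofFinite _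
  (PMF.uniformOfFintype (Fin m → W)).map fun x j => (x j : Packet F k)

/-- `m` independent uniformly random scalars. -/
def uniformScalars (F : Type) [Field F] [Finite F] (m : ℕ) : PMF (Fin m → F) :=
  letI : Fintype (Fin m → F) := Fintype.ofFinite _
  PMF.uniformOfFintype (Fin m → F)

/-- The two finite memory variants of random linear network coding. -/
inductive Variant where
  | accumulator
  | recombinator

/-- The law of the new active memory of `v` after it has received the packet `p`. The accumulator
adds an independent random multiple of `p` to each stored packet; the recombinator replaces the
stored packets by independent uniform samples from the span of its active packets and `p`. -/
def newMemory (src : Fin k → Set V) (σ : State V F k s) (v : V) (p : Packet F k) :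
    Variant → PMF (Fin s → Packet F k)
  | .accumulator => (uniformScalars F s).map fun c j => σ.mem v j + c j • p
  | .recombinator => uniformSamples (activeSpan src σ v ⊔ Submodule.span F {p}) s

/-- FM-RLNC with `s` active packets: the sender `u` sends a uniformly random vector of the span of
its active packets, and the receiver `v` updates its active memory. -/
def fmRLNC (var : Variant) (src : Fin k → Set V) : Protocol V F k s := fun σ u v =>
  (uniformSamples (activeSpan src σ u) 1).bind fun x =>
    (newMemory src σ v (x 0) var).map fun m => (x 0, m)

end FMRLNC

end NetCoding

end

/-! Upper bound. A node fails to decode exactly when some nonzero functional `φ` on `𝔽₂ⁿ` vanishes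
on everything it knows, so it suffices to bound this event by `4⁻ⁿ` for each fixed `φ` and to sum
over the `2ⁿ` functionals (`one_sub_le_successProb`). For fixed `φ`, spreading becomes a rumour
process: call a node informed if `φ` does not vanish on its active span. The sources keep the
informed set nonempty, and as long as some node is stuck, this set is not everything. A transfer out
of the set enlarges it with probability at least `1/4`; a transfer into an informed node makes that
node forget with probability at most `2⁻ˢ`.

The cut hypothesis averages over a window for a fixed set, whereas the informed set moves.
`exposure` compensates by crediting `Δ` for every change: each window then contributes at least
`ΔC`, either through a change (as `C ≤ 1`) or through the cuts of a constant set
(`exposure_window`). The potential `exp(exposure/8 − (Δ/8 + log 2)·|informed| − δt)`, with `δ =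
2·exp(Δ/4)·2⁻ˢ`, is a supermartingale starting at most at `1`. After order `n/C` rounds with a stuck
node it is at least `4ⁿ`, and Markov's inequality gives the bound (`toOuterMeasure_stuck_le`).
Logarithmic memory makes `δ ≤ C/32` (`forgetting_le`), so forgetting costs only a fraction of the
gain.

Lower bound. All messages start at node `0` of a directed cycle with edge probabilities `C`. Node
`1` receives packets over a single edge and needs `n` of them, but expects at most `TC ≤ n/2`;
Markov's inequality again. -/

namespace NetCoding

/-! ### Expectations of nonnegative functions -/

/-- The expectation of a nonnegative function. -/
noncomputable def expect {α : Type*} (p : PMF α) (f : α → ℝ≥0∞) : ℝ≥0∞ := ∑' x, p x * f x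

section Expect

variable {α β : Type*}

theorem expect_pure (a : α) (f : α → ℝ≥0∞) : expect (PMF.pure a) f = f a := by
  rw [expect, tsum_eq_single a]
  · simp
  · intro b hb
    simp [PMF.pure_apply, hb]

theorem expect_bind (p : PMF α) (g : α → PMF β) (f : β → ℝ≥0∞) :
    expect (p.bind g) f = expect p fun x => expect (g x) f := by
  simp only [expect, PMF.bind_apply, ← ENNReal.tsum_mul_right, ← ENNReal.tsum_mul_left]
  rw [ENNReal.tsum_comm]
  simp only [mul_assoc]

theorem expect_map (p : PMF α) (g : α → β) (f : β → ℝ≥0∞) :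
    expect (p.map g) f = expect p fun x => f (g x) := by
  rw [PMF.map, expect_bind]
  simp only [Function.comp_apply, expect_pure]

theorem expect_mono {p : PMF α} {f g : α → ℝ≥0∞} (h : ∀ x ∈ p.support, f x ≤ g x) :
    expect p f ≤ expect p g := by
  refine ENNReal.tsum_le_tsum fun x => ?_
  by_cases hx : p x = 0
  · simp [hx]
  · exact mul_le_mul_right (h x ((PMF.mem_support_iff _ _).2 hx)) _

theorem expect_const (p : PMF α) (c : ℝ≥0∞) : expect p (fun _ => c) = c := by
  rw [expect, ENNReal.tsum_mul_right, p.tsum_coe, one_mul]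

theorem expect_le_const {p : PMF α} {f : α → ℝ≥0∞} {c : ℝ≥0∞} (h : ∀ x ∈ p.support, f x ≤ c) :
    expect p f ≤ c :=
  (expect_mono h).trans (expect_const p c).le

theorem expect_add (p : PMF α) (f g : α → ℝ≥0∞) :
    expect p (fun x => f x + g x) = expect p f + expect p g := by
  simp only [expect, mul_add, ENNReal.tsum_add]

theorem expect_const_mul (p : PMF α) (c : ℝ≥0∞) (f : α → ℝ≥0∞) :
    expect p (fun x => c * f x) = c * expect p f := by
  simp only [expect, ← ENNReal.tsum_mul_left, mul_left_comm]

theorem toOuterMeasure_eq_expect (p : PMF α) (s : Set α) :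
    p.toOuterMeasure s = expect p (s.indicator 1) := by
  rw [PMF.toOuterMeasure_apply, expect]
  refine tsum_congr fun x => ?_
  by_cases hx : x ∈ s <;> simp [hx]

/-- Markov's inequality, where the lower bound is only needed on the support. -/
theorem mul_toOuterMeasure_le_expect (p : PMF α) (s : Set α) (c : ℝ≥0∞) (f : α → ℝ≥0∞)
    (h : ∀ x ∈ p.support, x ∈ s → c ≤ f x) : c * p.toOuterMeasure s ≤ expect p f := by
  rw [toOuterMeasure_eq_expect, ← expect_const_mul]
  refine expect_mono fun x hx => ?_
  by_cases hs : x ∈ s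
  · simpa [hs] using h x hx hs
  · simp [hs]

theorem one_sub_toOuterMeasure_compl_le (p : PMF α) (s : Set α) :
    1 - p.toOuterMeasure sᶜ ≤ p.toOuterMeasure s := by
  rw [tsub_le_iff_right, toOuterMeasure_eq_expect, toOuterMeasure_eq_expect, ← expect_add]
  refine ((expect_const p 1).symm.le).trans (expect_mono fun x _ => ?_)
  by_cases hs : x ∈ s <;> simp [hs]

/-- Counting: `2 ^ m` disjoint copies of the event fit into the sample space. This replaces all
independence arguments about random coefficients. -/
theorem toOuterMeasure_uniformOfFintype_le [Fintype α] [Nonempty α] (s : Set α) (m : ℕ)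
    (f : (Fin m → ZMod 2) × s → α) (hf : Function.Injective f) :
    (PMF.uniformOfFintype α).toOuterMeasure s ≤ (1 / 2) ^ m := by
  classical
  rw [PMF.toOuterMeasure_uniformOfFintype_apply]
  have hc : 2 ^ m * Fintype.card s ≤ Fintype.card α := by
    simpa using Fintype.card_le_of_injective f hf
  refine ENNReal.div_le_of_le_mul ?_
  have hc' : (2 : ℝ≥0∞) ^ m * Fintype.card s ≤ Fintype.card α := by exact_mod_cast hc
  calc (Fintype.card s : ℝ≥0∞) = (1 / 2) ^ m * (2 ^ m * Fintype.card s) := by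
        rw [← mul_assoc, ← mul_pow, one_div, ENNReal.inv_mul_cancel two_ne_zero ENNReal.ofNat_ne_top,
          one_pow, one_mul]
    _ ≤ _ := by gcongr

end Expect

/-! ### Functionals on packets -/

section Functionals

theorem zmod_two_eq_one_of_ne_zero {x : ZMod 2} (h : x ≠ 0) : x = 1 := by
  revert x; decide

variable {V : Type} {k s : ℕ}

theorem exists_mem_span_ne_zero_iff {R M : Type*} [CommRing R] [AddCommGroup M] [Module R M]
    (φ : Module.Dual R M) (S : Set M) :
    (∃ x ∈ Submodule.span R S, φ x ≠ 0) ↔ ∃ x ∈ S, φ x ≠ 0 := by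
  constructor
  · rintro ⟨x, hx, h⟩
    by_contra! hS
    exact h ((Submodule.span_le (p := LinearMap.ker φ)).2 hS hx)
  · rintro ⟨x, hx, h⟩
    exact ⟨x, Submodule.subset_span hx, h⟩

/-- Uniform samples of a subspace are all in the kernel of a functional, which does not vanish on
the subspace, with probability at most `2 ^ (-m)`. -/
theorem uniformSamples_ker_le (W : Submodule (ZMod 2) (Packet (ZMod 2) k))
    (φ : Module.Dual (ZMod 2) (Packet (ZMod 2) k)) (hW : ∃ x ∈ W, φ x ≠ 0) (m : ℕ) :
    (uniformSamples W m).toOuterMeasure {x | ∀ j, φ (x j) = 0} ≤ (1 / 2) ^ m := by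
  obtain ⟨w, hw, hφ⟩ := hW
  have h1 : φ w = 1 := zmod_two_eq_one_of_ne_zero hφ
  rw [uniformSamples, PMF.toOuterMeasure_map_apply]
  -- Shift the kernel samples by multiples of `w`; since `φ w = 1`, applying `φ` recovers the
  -- multiples, hence injectivity.
  refine @toOuterMeasure_uniformOfFintype_le _ (Fintype.ofFinite _) _ _ m
    (fun x j => x.2.1 j + x.1 j • ⟨w, hw⟩) ?_
  rintro ⟨c, x, hx⟩ ⟨d, y, hy⟩ h
  have hx' : ∀ j, φ (x j) = 0 := hx
  have hy' : ∀ j, φ (y j) = 0 := hy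
  have hj : ∀ j, (x j : Packet (ZMod 2) k) + c j • w = y j + d j • w := fun j =>
    congrArg Subtype.val (congrFun h j)
  have hcd : c = d := by
    funext j
    simpa [hx', hy', h1] using congrArg φ (hj j)
  subst hcd
  have hxy : x = y := by
    funext j
    exact Subtype.ext (add_right_cancel (hj j))
  subst hxy
  rfl

/-- The set of nodes whose active packets are not all in the kernel of `φ`. -/
noncomputable def informed [Fintype V] (src : Fin k → Set V)
    (φ : Module.Dual (ZMod 2) (Packet (ZMod 2) k)) (σ : State V (ZMod 2) k s) : Finset V :=
  open scoped Classical in Finset.univ.filter fun v => ∃ x ∈ activeSpan src σ v, φ x ≠ 0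

variable [Fintype V] {src : Fin k → Set V} {φ : Module.Dual (ZMod 2) (Packet (ZMod 2) k)}
  {σ : State V (ZMod 2) k s} {v : V}

theorem mem_informed : v ∈ informed src φ σ ↔ ∃ x ∈ activeSpan src σ v, φ x ≠ 0 := by
  simp [informed]

theorem mem_informed_iff : v ∈ informed src φ σ ↔
    (∃ x ∈ sourcePackets src v, φ x ≠ 0) ∨ ∃ j, φ (σ.mem v j) ≠ 0 := by
  rw [mem_informed, activeSpan, exists_mem_span_ne_zero_iff]
  simp only [Set.mem_union, or_and_right, exists_or, Set.mem_range, exists_exists_eq_and]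

/-- A nonzero functional is nonzero on some unit vector, and the sources of that message never drop
it. -/
theorem informed_nonempty (hsrc : ∀ i, (src i).Nonempty) (hφ : φ ≠ 0) :
    (informed src φ σ).Nonempty := by
  have : ∃ i, φ (Pi.single i 1) ≠ 0 := by
    by_contra! h
    refine hφ (LinearMap.pi_ext' fun i => LinearMap.ext_ring ?_)
    simpa using h i
  obtain ⟨i, hi⟩ := this
  obtain ⟨v, hv⟩ := hsrc i
  exact ⟨v, mem_informed_iff.2 (Or.inl ⟨_, ⟨i, hv, rfl⟩, hi⟩)⟩

end Functionals

/-! ### One transfer -/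

section Transfer

variable {V : Type} {k s : ℕ}

theorem mem_of_mem_support_uniformSamples {F : Type} [Field F] [Finite F]
    {W : Submodule F (Packet F k)} {m : ℕ} {x : Fin m → Packet F k}
    (h : x ∈ (uniformSamples W m).support) (j : Fin m) : x j ∈ W := by
  rw [uniformSamples, PMF.support_map] at h
  obtain ⟨y, -, rfl⟩ := h
  exact (y j).2

theorem mem_of_mem_support_newMemory {F : Type} [Field F] [Finite F] {src : Fin k → Set V}
    {σ : State V F k s} {p : Packet F k} {var : Variant} {m : Fin s → Packet F k} {v : V}
    (h : m ∈ (newMemory src σ v p var).support) (j : Fin s) :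
    m j ∈ activeSpan src σ v ⊔ Submodule.span F {p} := by
  cases var with
  | accumulator =>
    rw [newMemory, PMF.support_map] at h
    obtain ⟨c, -, rfl⟩ := h
    refine add_mem (Submodule.mem_sup_left (Submodule.subset_span (Or.inr ⟨j, rfl⟩)))
      (Submodule.mem_sup_right (Submodule.smul_mem _ _ (Submodule.mem_span_singleton_self p)))
  | recombinator => exact mem_of_mem_support_uniformSamples h j

variable [DecidableEq V]

/-- The weight of a change of the informed set from `K` to `K'`: changes in either direction get a
bonus, and growth is penalized. -/
noncomputable def jumpWeight (Δ : ℕ) (K K' : Finset V) : ℝ≥0∞ :=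
  ENNReal.ofReal (Real.exp ((if K' = K then 0 else (Δ : ℝ)) / 8
    - ((Δ : ℝ) / 8 + Real.log 2) * ((K'.card : ℝ) - K.card)))

theorem jumpWeight_self (Δ : ℕ) (K : Finset V) : jumpWeight Δ K K = 1 := by
  simp [jumpWeight]

/-- The growth penalty is chosen so that its `Δ / 8` cancels the bonus for a change, leaving the
factor `exp (-log 2)`. When a node is lost, the two terms add up to `Δ / 4` instead. -/
theorem jumpWeight_insert (Δ : ℕ) {v : V} {K : Finset V} (h : v ∉ K) :
    jumpWeight Δ K (insert v K) = 1 / 2 := by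
  have : insert v K ≠ K := by simpa using h
  rw [jumpWeight, if_neg this, Finset.card_insert_of_notMem h]
  push_cast
  rw [show (Δ : ℝ) / 8 - ((Δ : ℝ) / 8 + Real.log 2) * (K.card + 1 - K.card) = - Real.log 2 by ring,
    Real.exp_neg, Real.exp_log two_pos, ENNReal.ofReal_inv_of_pos two_pos]
  simp

theorem jumpWeight_erase (Δ : ℕ) {v : V} {K : Finset V} (h : v ∈ K) :
    jumpWeight Δ K (K.erase v) = ENNReal.ofReal (2 * Real.exp (Δ / 4)) := by
  have : K.erase v ≠ K := by simpa using h
  have hc : ((K.erase v).card : ℝ) = K.card - 1 := by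
    rw [← Finset.card_erase_add_one h]; push_cast; ring
  rw [jumpWeight, if_neg this, hc,
    show (Δ : ℝ) / 8 - ((Δ : ℝ) / 8 + Real.log 2) * (K.card - 1 - K.card)
      = Real.log 2 + Δ / 4 by ring, Real.exp_add, Real.exp_log two_pos]

/-- The state after `v` has received `p` and has changed its stored packets to `m`. -/
abbrev State.receive {F : Type} (σ : State V F k s) (v : V) (p : Packet F k)
    (m : Fin s → Packet F k) : State V F k s where
  mem := Function.update σ.mem v m
  inbox := Function.update σ.inbox v (p :: σ.inbox v)

variable [Fintype V] {src : Fin k → Set V} {φ : Module.Dual (ZMod 2) (Packet (ZMod 2) k)}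
  {σ : State V (ZMod 2) k s} {u v : V} {p : Packet (ZMod 2) k}

theorem mem_informed_receive_of_ne {w : V} (h : w ≠ v) (m : Fin s → Packet (ZMod 2) k) :
    w ∈ informed src φ (σ.receive v p m) ↔ w ∈ informed src φ σ := by
  simp [mem_informed_iff, Function.update_of_ne h]

theorem mem_informed_receive (m : Fin s → Packet (ZMod 2) k) :
    v ∈ informed src φ (σ.receive v p m) ↔
      (∃ x ∈ sourcePackets src v, φ x ≠ 0) ∨ ∃ j, φ (m j) ≠ 0 := by
  simp [mem_informed_iff]

theorem informed_receive_of_mem {m : Fin s → Packet (ZMod 2) k}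
    (h : v ∈ informed src φ (σ.receive v p m)) :
    informed src φ (σ.receive v p m) = insert v (informed src φ σ) := by
  ext w
  by_cases hw : w = v
  · subst hw; simp [h]
  · simp only [Finset.mem_insert, hw, false_or, mem_informed_receive_of_ne hw]

theorem informed_receive_of_notMem {m : Fin s → Packet (ZMod 2) k}
    (h : v ∉ informed src φ (σ.receive v p m)) :
    informed src φ (σ.receive v p m) = (informed src φ σ).erase v := by
  ext w
  by_cases hw : w = v
  · subst hw; simp [h]
  · simp only [Finset.mem_erase, ne_eq, hw, not_false_iff, true_and, mem_informed_receive_of_ne hw]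

/-- If the receiver was informed or the packet carries information, then the receiver is not
informed afterwards with probability at most `2 ^ (-s)`. -/
theorem newMemory_notMem_informed_le (var : Variant)
    (h : v ∈ informed src φ σ ∨ φ p ≠ 0) :
    (newMemory src σ v p var).toOuterMeasure {m | v ∉ informed src φ (σ.receive v p m)} ≤
      (1 / 2) ^ s := by
  cases var with
  | accumulator =>
    rw [newMemory, uniformScalars, PMF.toOuterMeasure_map_apply]
    -- A packet in the kernel leaves all `φ`-values of the memory unchanged, so an informed receiver
    -- cannot forget.
    by_cases hp : φ p = 0
    · have hv := mem_informed_iff.1 (h.resolve_right (not_not_intro hp))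
      rw [show (_ ⁻¹' _ : Set (Fin s → ZMod 2)) = ∅ from ?_]
      · simp
      · ext c
        simpa [mem_informed_receive, hp, imp_iff_not_or] using hv
    -- Becoming uninformed forces each scalar to cancel the `φ`-value of its slot. The event thus
    -- has at most one element, and the projection is injective.
    · refine @toOuterMeasure_uniformOfFintype_le _ (Fintype.ofFinite _) _ _ s (fun x => x.1) ?_
      have hp1 := zmod_two_eq_one_of_ne_zero hp
      rintro ⟨c, x, hx⟩ ⟨d, y, hy⟩ hcd
      have key : ∀ z : Fin s → ZMod 2,
          v ∉ informed src φ (σ.receive v p fun j => σ.mem v j + z j • p) →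
          ∀ j, z j = - φ (σ.mem v j) := by
        intro z hz j
        rw [mem_informed_receive, not_or] at hz
        have := hz.2
        push Not at this
        have := this j
        simp only [map_add, map_smul, hp1, smul_eq_mul, mul_one] at this
        exact (neg_eq_of_add_eq_zero_right this).symm
      have hxy : x = y := funext fun j => (key x hx j).trans (key y hy j).symm
      subst hxy
      exact Prod.ext hcd rfl
  | recombinator =>
    rw [newMemory]
    refine le_trans ((PMF.toOuterMeasure _).mono ?_) (uniformSamples_ker_le _ φ ?_ s)
    · intro m hm
      rw [Set.mem_ofPred_eq, mem_informed_receive, not_or] at hm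
      simpa using hm.2
    · rcases h with h | h
      · obtain ⟨x, hx, hx'⟩ := mem_informed.1 h
        exact ⟨x, Submodule.mem_sup_left hx, hx'⟩
      · exact ⟨p, Submodule.mem_sup_right (Submodule.mem_span_singleton_self p), h⟩

theorem expect_newMemory_jumpWeight_of_mem (var : Variant) (Δ : ℕ) (hv : v ∈ informed src φ σ) :
    expect (newMemory src σ v p var)
      (fun m => jumpWeight Δ (informed src φ σ) (informed src φ (σ.receive v p m))) ≤
    1 + ENNReal.ofReal (2 * Real.exp (Δ / 4)) * (1 / 2) ^ s := by
  refine le_trans (expect_mono (g := fun m => 1 + ENNReal.ofReal (2 * Real.exp (Δ / 4)) *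
    Set.indicator {m | v ∉ informed src φ (σ.receive v p m)} 1 m) fun m _ => ?_) ?_
  · by_cases hm : v ∈ informed src φ (σ.receive v p m)
    · rw [informed_receive_of_mem hm, Finset.insert_eq_of_mem hv, jumpWeight_self]
      exact le_self_add
    · rw [informed_receive_of_notMem hm, jumpWeight_erase Δ hv,
        Set.indicator_of_mem (by exact hm)]
      simp
  · rw [expect_add, expect_const, expect_const_mul, ← toOuterMeasure_eq_expect]
    gcongr
    exact newMemory_notMem_informed_le var (Or.inl hv)

theorem expect_newMemory_jumpWeight_of_notMem (var : Variant) (Δ : ℕ)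
    (hv : v ∉ informed src φ σ) :
    expect (newMemory src σ v p var)
      (fun m => jumpWeight Δ (informed src φ σ) (informed src φ (σ.receive v p m))) ≤ 1 := by
  refine expect_le_const fun m _ => ?_
  by_cases hm : v ∈ informed src φ (σ.receive v p m)
  · rw [informed_receive_of_mem hm, jumpWeight_insert Δ hv]
    simp
  · rw [informed_receive_of_notMem hm, Finset.erase_eq_of_notMem hv, jumpWeight_self]

theorem expect_newMemory_jumpWeight_of_informative (var : Variant) (Δ : ℕ) (hs : 1 ≤ s)
    (hv : v ∉ informed src φ σ) (hp : φ p ≠ 0) :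
    expect (newMemory src σ v p var)
      (fun m => jumpWeight Δ (informed src φ σ) (informed src φ (σ.receive v p m))) ≤ 3 / 4 := by
  -- The weight is `1 / 2` if `v` becomes informed and `1` otherwise; the latter has probability at
  -- most `1 / 2` because `s ≥ 1`.
  refine le_trans (expect_mono (g := fun m => 1 / 2 + 1 / 2 *
    Set.indicator {m | v ∉ informed src φ (σ.receive v p m)} 1 m) fun m _ => ?_) ?_
  · by_cases hm : v ∈ informed src φ (σ.receive v p m)
    · rw [informed_receive_of_mem hm, jumpWeight_insert Δ hv]
      exact le_self_add
    · rw [informed_receive_of_notMem hm, Finset.erase_eq_of_notMem hv, jumpWeight_self,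
        Set.indicator_of_mem (by exact hm)]
      simp [ENNReal.inv_two_add_inv_two]
  · rw [expect_add, expect_const, expect_const_mul, ← toOuterMeasure_eq_expect]
    have h1 : ((1 : ℝ≥0∞) / 2) ^ s ≤ (1 / 2) ^ 1 := pow_le_pow_of_le_one zero_le (by simp) hs
    calc _ ≤ (1 / 2 : ℝ≥0∞) + 1 / 2 * (1 / 2) ^ 1 := by
          gcongr
          exact (newMemory_notMem_informed_le var (Or.inr hp)).trans h1
      _ = 3 / 4 := by
        rw [← ENNReal.toReal_eq_toReal_iff' (by finiteness) (by finiteness),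
          ENNReal.toReal_add (by finiteness) (by finiteness)]
        simp
        norm_num

/-- The expected weight of the change of the informed set in one transfer. -/
theorem expect_fmRLNC_jumpWeight_add_le (var : Variant) (Δ : ℕ) (hs : 1 ≤ s) (u v : V) :
    expect (fmRLNC var src σ u v)
      (fun x => jumpWeight Δ (informed src φ σ) (informed src φ (σ.receive v x.1 x.2))) +
        (if u ∈ informed src φ σ ∧ v ∉ informed src φ σ then 1 / 8 else 0) ≤
    1 + ENNReal.ofReal (2 * Real.exp (Δ / 4)) * (1 / 2) ^ s := by
  simp only [fmRLNC, expect_bind, expect_map]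
  by_cases hv : v ∈ informed src φ σ
  · simp only [hv, not_true_eq_false, and_false, if_false, add_zero]
    exact expect_le_const fun x _ => expect_newMemory_jumpWeight_of_mem var Δ hv
  · refine le_trans ?_ (le_self_add (b := ENNReal.ofReal (2 * Real.exp (Δ / 4)) * (1 / 2) ^ s))
    by_cases hu : u ∈ informed src φ σ
    · simp only [hu, hv, not_false_iff, and_self, if_true]
      -- The bound is `3 / 4` for an informative packet and `1` otherwise. The sent packet is
      -- uninformative with probability at most `1 / 2`, so the mean is at most `7 / 8`, which
      -- leaves the `1 / 8` for the crossing term.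
      have h : expect (uniformSamples (activeSpan src σ u) 1) (fun x =>
          expect (newMemory src σ v (x 0) var) fun m =>
            jumpWeight Δ (informed src φ σ) (informed src φ (σ.receive v (x 0) m))) ≤
          3 / 4 + 1 / 4 * (1 / 2) ^ 1 := by
        refine le_trans (expect_mono (g := fun x => 3 / 4 + 1 / 4 *
          Set.indicator {x | ∀ j, φ (x j) = 0} 1 x) fun x _ => ?_) ?_
        · by_cases hx : φ (x 0) = 0
          · refine (expect_newMemory_jumpWeight_of_notMem var Δ hv).trans ?_
            rw [Set.indicator_of_mem (by
              intro j
              rwa [Subsingleton.elim j 0])]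
            rw [Pi.one_apply, mul_one, ← ENNReal.toReal_le_toReal (by finiteness) (by finiteness),
              ENNReal.toReal_add (by finiteness) (by finiteness)]
            simp
            norm_num
          · exact (expect_newMemory_jumpWeight_of_informative var Δ hs hv hx).trans le_self_add
        · rw [expect_add, expect_const, expect_const_mul, ← toOuterMeasure_eq_expect]
          gcongr
          exact uniformSamples_ker_le _ φ (mem_informed.1 hu) 1
      refine (add_le_add_left h _).trans ?_
      rw [← ENNReal.toReal_le_toReal (by finiteness) (by finiteness),
        ENNReal.toReal_add (by finiteness) (by finiteness),
        ENNReal.toReal_add (by finiteness) (by finiteness)]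
      simp
      norm_num
    · simp only [hu, false_and, if_false, add_zero]
      exact expect_le_const fun x _ => expect_newMemory_jumpWeight_of_notMem var Δ hv

end Transfer

/-! ### The exponential potential -/

section Potential

variable {V : Type} [DecidableEq V] [Fintype V] {k s : ℕ}

theorem cutWeight_nonneg (p : PMF (V × V)) (S : Finset V) : 0 ≤ cutWeight p S :=
  Finset.sum_nonneg fun _ _ => Finset.sum_nonneg fun _ _ => ENNReal.toReal_nonneg

theorem expect_crossing (p : PMF (V × V)) (S : Finset V) (c : ℝ≥0∞) :
    expect p (fun e => if e.1 ∈ S ∧ e.2 ∉ S then c else 0) =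
      ENNReal.ofReal (cutWeight p S) * c := by
  have h : ENNReal.ofReal (cutWeight p S) = ∑ u ∈ S, ∑ v ∈ Sᶜ, p (u, v) := by
    rw [cutWeight, ENNReal.ofReal_sum_of_nonneg
      fun _ _ => Finset.sum_nonneg fun _ _ => ENNReal.toReal_nonneg]
    refine Finset.sum_congr rfl fun u _ => ?_
    rw [ENNReal.ofReal_sum_of_nonneg fun _ _ => ENNReal.toReal_nonneg]
    exact Finset.sum_congr rfl fun v _ => ENNReal.ofReal_toReal (p.apply_ne_top _)
  rw [h, ← Finset.sum_product', expect, tsum_fintype, Finset.sum_mul]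
  simp only [mul_ite, mul_zero]
  rw [← Finset.sum_filter]
  refine Finset.sum_congr ?_ fun _ _ => rfl
  ext e
  simp

theorem cutWeight_le_one (p : PMF (V × V)) (S : Finset V) : cutWeight p S ≤ 1 := by
  have h := expect_crossing p S 1
  rw [mul_one] at h
  have h1 : ENNReal.ofReal (cutWeight p S) ≤ 1 :=
    h ▸ expect_le_const fun e _ => by split_ifs <;> simp
  simpa using h1

/-- The accumulated weight of the cuts of the informed set, where every change of the informed set
counts for a full window of length `Δ`. -/
noncomputable def exposure (A : Adversary V (ZMod 2) k s) (src : Fin k → Set V)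
    (φ : Module.Dual (ZMod 2) (Packet (ZMod 2) k)) (Δ : ℕ) : History V (ZMod 2) k s → ℝ
  | [] => 0
  | σ :: h => exposure A src φ Δ h + (cutWeight (A h) (informed src φ (History.current h)) +
      if informed src φ σ = informed src φ (History.current h) then 0 else (Δ : ℝ))

/-- The supermartingale that controls the spreading of a functional `φ`. -/
noncomputable def potential (A : Adversary V (ZMod 2) k s) (src : Fin k → Set V)
    (φ : Module.Dual (ZMod 2) (Packet (ZMod 2) k)) (Δ : ℕ) (h : History V (ZMod 2) k s) : ℝ≥0∞ :=
  ENNReal.ofReal (Real.exp (exposure A src φ Δ h / 8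
    - ((Δ : ℝ) / 8 + Real.log 2) * (informed src φ h.current).card
    - 2 * Real.exp (Δ / 4) * (1 / 2) ^ s * h.length))

variable {A : Adversary V (ZMod 2) k s} {src : Fin k → Set V}
  {φ : Module.Dual (ZMod 2) (Packet (ZMod 2) k)} {var : Variant} {Δ : ℕ}

theorem potential_cons (σ : State V (ZMod 2) k s) (h : History V (ZMod 2) k s) :
    potential A src φ Δ (σ :: h) = potential A src φ Δ h *
      ENNReal.ofReal (Real.exp (cutWeight (A h) (informed src φ h.current) / 8
        - 2 * Real.exp (Δ / 4) * (1 / 2) ^ s)) *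
      jumpWeight Δ (informed src φ h.current) (informed src φ σ) := by
  rw [potential, potential, jumpWeight, ← ENNReal.ofReal_mul (Real.exp_nonneg _),
    ← ENNReal.ofReal_mul (by positivity), ← Real.exp_add, ← Real.exp_add, exposure]
  congr 2
  simp only [List.length_cons, History.current, List.headD_cons]
  push_cast
  ring

theorem expect_step_jumpWeight_add_le (hs : 1 ≤ s) (h : History V (ZMod 2) k s) :
    expect (step (fmRLNC var src) A h)
      (fun σ => jumpWeight Δ (informed src φ h.current) (informed src φ σ)) +
        ENNReal.ofReal (cutWeight (A h) (informed src φ h.current)) * (1 / 8) ≤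
    1 + ENNReal.ofReal (2 * Real.exp (Δ / 4)) * (1 / 2) ^ s := by
  rw [← expect_crossing, step, expect_bind, ← expect_add]
  refine expect_le_const fun e _ => ?_
  obtain ⟨u, v⟩ := e
  by_cases huv : u = v
  · subst huv
    simp only [if_true, expect_pure, jumpWeight_self, and_not_self_iff, if_false, add_zero]
    exact le_self_add
  · simp only [huv, if_false, expect_map]
    exact expect_fmRLNC_jumpWeight_add_le var Δ hs u v

theorem expect_step_potential_le (hs : 1 ≤ s) (h : History V (ZMod 2) k s) :
    expect (step (fmRLNC var src) A h) (fun σ => potential A src φ Δ (σ :: h)) ≤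
      potential A src φ Δ h := by
  have key := expect_step_jumpWeight_add_le (A := A) (src := src) (φ := φ) (var := var) (Δ := Δ) hs h
  simp only [potential_cons, expect_const_mul]
  set E := expect (step (fmRLNC var src) A h)
    (fun σ => jumpWeight Δ (informed src φ h.current) (informed src φ σ))
  set w := cutWeight (A h) (informed src φ h.current)
  have hw : 0 ≤ w := cutWeight_nonneg _ _
  set δ := 2 * Real.exp (Δ / 4) * (1 / 2) ^ s with hδ
  have hδ0 : 0 ≤ δ := by positivity
  have hD : (1 : ℝ≥0∞) + ENNReal.ofReal (2 * Real.exp (Δ / 4)) * (1 / 2) ^ s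
      = ENNReal.ofReal (1 + δ) := by
    rw [ENNReal.ofReal_add zero_le_one hδ0, hδ, ENNReal.ofReal_mul (q := (1 / 2) ^ s) (by positivity),
      ENNReal.ofReal_pow (p := 1 / 2) (by positivity), ENNReal.ofReal_one,
      ENNReal.ofReal_div_of_pos two_pos, ENNReal.ofReal_one, ENNReal.ofReal_ofNat]
  have hw8 : ENNReal.ofReal w * (1 / 8) = ENNReal.ofReal (w / 8) := by
    rw [ENNReal.ofReal_div_of_pos (by norm_num), ENNReal.ofReal_ofNat, mul_one_div]
  rw [hD, hw8] at key
  have hE : E ≤ ENNReal.ofReal (Real.exp (-(w / 8 - δ))) := by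
    refine (ENNReal.le_sub_of_add_le_right ENNReal.ofReal_ne_top key).trans ?_
    rw [← ENNReal.ofReal_sub _ (by positivity)]
    refine ENNReal.ofReal_le_ofReal ?_
    -- The mean jump weight is at most `1 + δ - w / 8`, and `1 + x ≤ exp x` matches it to the
    -- deterministic factor of the potential.
    have := Real.add_one_le_exp (-(w / 8 - δ))
    linarith
  calc _ ≤ potential A src φ Δ h * ENNReal.ofReal (Real.exp (w / 8 - δ)) *
        ENNReal.ofReal (Real.exp (-(w / 8 - δ))) := by gcongr
    _ = potential A src φ Δ h := by
      rw [mul_assoc, ← ENNReal.ofReal_mul (Real.exp_nonneg _), ← Real.exp_add]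
      simp

theorem expect_run_potential_le (hs : 1 ≤ s) (T : ℕ) :
    expect (run (fmRLNC var src) A T) (potential A src φ Δ) ≤ 1 := by
  induction T with
  | zero =>
    rw [run, expect_pure, potential, exposure, ← ENNReal.ofReal_one]
    refine ENNReal.ofReal_le_ofReal ?_
    rw [Real.exp_le_one_iff]
    have : 0 ≤ ((Δ : ℝ) / 8 + Real.log 2) * (informed src φ
      (History.current ([] : History V (ZMod 2) k s))).card := by positivity
    simp only [List.length_nil]
    push_cast
    linarith
  | succ T ih =>
    simp only [run, expect_bind, expect_map]
    exact (expect_mono fun h _ => expect_step_potential_le hs h).trans ih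

end Potential

/-! ### Courses of events -/

section Paths

variable {V F : Type} [DecidableEq V] [Field F] {k s : ℕ}

theorem mem_support_run_succ {P : Protocol V F k s} {A : Adversary V F k s} {t : ℕ}
    {h : History V F k s} : h ∈ (run P A (t + 1)).support ↔
      ∃ h' ∈ (run P A t).support, ∃ σ ∈ (step P A h').support, h = σ :: h' := by
  simp only [run, PMF.mem_support_bind_iff, PMF.mem_support_map_iff, eq_comm]

theorem length_of_mem_support_run {P : Protocol V F k s} {A : Adversary V F k s} {t : ℕ}
    {h : History V F k s} (hh : h ∈ (run P A t).support) : h.length = t := by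
  induction t generalizing h with
  | zero => simp_all [run]
  | succ t ih =>
    obtain ⟨h', hh', σ, -, rfl⟩ := mem_support_run_succ.1 hh
    simp [ih hh']

theorem drop_mem_support_run {P : Protocol V F k s} {A : Adversary V F k s} {t j : ℕ}
    {h : History V F k s} (hh : h ∈ (run P A (t + j)).support) :
    h.drop j ∈ (run P A t).support := by
  induction j generalizing h with
  | zero => simpa using hh
  | succ j ih =>
    obtain ⟨h', hh', σ, -, rfl⟩ := mem_support_run_succ.1 hh
    exact ih hh'

/-- The span of the initial packets and all received packets of `v`. -/
def knowledge (src : Fin k → Set V) (σ : State V F k s) (v : V) : Submodule F (Packet F k) :=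
  Submodule.span F (sourcePackets src v ∪ {x | x ∈ σ.inbox v})

theorem knowledge_le_receive (src : Fin k → Set V) (σ : State V F k s) (v w : V)
    (p : Packet F k) (m : Fin s → Packet F k) :
    knowledge src σ w ≤ knowledge src (σ.receive v p m) w := by
  refine Submodule.span_mono (Set.union_subset_union_right _ fun x hx => ?_)
  by_cases hw : w = v
  · subst hw
    simpa using Or.inr hx
  · simpa [Function.update_of_ne hw] using hx

theorem mem_knowledge_receive (src : Fin k → Set V) (σ : State V F k s) (v : V)
    (p : Packet F k) (m : Fin s → Packet F k) : p ∈ knowledge src (σ.receive v p m) v :=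
  Submodule.subset_span (Or.inr (by simp))

variable [Finite F] {src : Fin k → Set V} {var : Variant} {A : Adversary V F k s}

/-- New stored packets are combinations of the old active ones and of the received packet, which
also enters the inbox. This links the memory, where spreading takes place, to the inbox, where
decoding does. -/
theorem knowledge_step {h : History V F k s} {σ : State V F k s}
    (hσ : σ ∈ (step (fmRLNC var src) A h).support)
    (hh : ∀ v, activeSpan src h.current v ≤ knowledge src h.current v) (v : V) :
    knowledge src h.current v ≤ knowledge src σ v ∧
      activeSpan src σ v ≤ knowledge src σ v := by
  rw [step, PMF.mem_support_bind_iff] at hσ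
  obtain ⟨⟨u, w⟩, -, hσ⟩ := hσ
  by_cases huw : u = w
  · rw [if_pos huw, PMF.mem_support_pure_iff] at hσ
    subst hσ
    exact ⟨le_rfl, hh v⟩
  · rw [if_neg huw, PMF.mem_support_map_iff] at hσ
    obtain ⟨⟨p, m⟩, hx, rfl⟩ := hσ
    have hle := knowledge_le_receive src h.current w v p m
    refine ⟨hle, ?_⟩
    by_cases hv : v = w
    · subst hv
      have hm : m ∈ (newMemory src h.current v p var).support := by
        rw [fmRLNC, PMF.mem_support_bind_iff] at hx
        obtain ⟨y, -, hx⟩ := hx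
        rw [PMF.mem_support_map_iff] at hx
        obtain ⟨m', hm', he⟩ := hx
        rw [Prod.mk.injEq] at he
        rwa [← he.1, ← he.2]
      refine Submodule.span_le.2 (Set.union_subset (fun x hx => Submodule.subset_span (Or.inl hx)) ?_)
      rintro _ ⟨j, rfl⟩
      have := mem_of_mem_support_newMemory hm j
      refine SetLike.mem_coe.2 (sup_le ((hh v).trans hle) ?_ (by simpa using this))
      rw [Submodule.span_singleton_le_iff_mem]
      exact mem_knowledge_receive src h.current v p m
    · refine le_trans (le_of_eq ?_) ((hh v).trans hle)
      simp [activeSpan, Function.update_of_ne hv]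

theorem activeSpan_le_knowledge {t : ℕ} {h : History V F k s}
    (hh : h ∈ (run (fmRLNC var src) A t).support) (v : V) :
    activeSpan src h.current v ≤ knowledge src h.current v := by
  induction t generalizing h v with
  | zero =>
    obtain rfl : h = [] := by simpa [run] using hh
    refine Submodule.span_le.2 (Set.union_subset (fun x hx => Submodule.subset_span (Or.inl hx)) ?_)
    rintro _ ⟨j, rfl⟩
    exact zero_mem _
  | succ t ih =>
    obtain ⟨h', hh', σ, hσ, rfl⟩ := mem_support_run_succ.1 hh
    exact (knowledge_step hσ (ih hh') v).2

theorem knowledge_drop_le {t j : ℕ} {h : History V F k s}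
    (hh : h ∈ (run (fmRLNC var src) A (t + j)).support) (v : V) :
    knowledge src (History.current (h.drop j)) v ≤ knowledge src h.current v := by
  induction j generalizing h with
  | zero => simp
  | succ j ih =>
    obtain ⟨h', hh', σ, hσ, rfl⟩ := mem_support_run_succ.1 hh
    exact (ih hh').trans (knowledge_step hσ (activeSpan_le_knowledge hh') v).1

end Paths

/-! ### Exposure accumulated while a node is stuck -/

section Exposure

variable {V : Type} [DecidableEq V] [Fintype V] {k s : ℕ} {A : Adversary V (ZMod 2) k s}
  {src : Fin k → Set V} {φ : Module.Dual (ZMod 2) (Packet (ZMod 2) k)} {var : Variant} {Δ : ℕ}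

theorem exposure_nonneg (h : History V (ZMod 2) k s) : 0 ≤ exposure A src φ Δ h := by
  induction h with
  | nil => exact le_rfl
  | cons σ h ih =>
    have := cutWeight_nonneg (A h) (informed src φ (History.current h))
    rw [exposure]
    split_ifs <;> positivity

/-- Either the informed set has changed in the last `j` rounds, or it has been constant and was
exposed to all of its cuts. -/
theorem exposure_drop (h : History V (ZMod 2) k s) (j : ℕ) (hj : j ≤ h.length) :
    exposure A src φ Δ (h.drop j) + Δ ≤ exposure A src φ Δ h ∨
      informed src φ (History.current (h.drop j)) = informed src φ h.current ∧
      exposure A src φ Δ h = exposure A src φ Δ (h.drop j) +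
        ∑ i ∈ Finset.range j, cutWeight (A (h.drop (i + 1))) (informed src φ h.current) := by
  induction j with
  | zero => simp
  | succ j ih =>
    have hlt : j < h.length := hj
    have hd : h.drop j = h[j] :: h.drop (j + 1) := List.drop_eq_getElem_cons hlt
    have hw := cutWeight_nonneg (A (h.drop (j + 1)))
      (informed src φ (History.current (h.drop (j + 1))))
    have hcur : History.current (h.drop j) = h[j] := by rw [hd]; rfl
    have he : exposure A src φ Δ (h.drop j) = exposure A src φ Δ (h.drop (j + 1)) +
      (cutWeight (A (h.drop (j + 1))) (informed src φ (History.current (h.drop (j + 1)))) +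
      if informed src φ h[j] = informed src φ (History.current (h.drop (j + 1))) then 0
        else (Δ : ℝ)) := by
      rw [hd, exposure]
    rcases ih hlt.le with h1 | ⟨h1, h2⟩
    · left
      split_ifs at he <;> linarith [(Nat.cast_nonneg Δ : (0 : ℝ) ≤ Δ)]
    · rw [hcur] at h1
      -- Extending the window one round into the past: either the set stays constant and one cut is
      -- added, or the change already pays `Δ`.
      by_cases hc : informed src φ h[j] = informed src φ (History.current (h.drop (j + 1)))
      · right
        rw [if_pos hc, ← hc, h1] at he
        refine ⟨hc.symm.trans h1, ?_⟩
        rw [h2, he, Finset.sum_range_succ]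
        ring
      · left
        rw [if_neg hc] at he
        have := Finset.sum_nonneg fun i (_ : i ∈ Finset.range j) =>
          cutWeight_nonneg (A (h.drop (i + 1))) (informed src φ h.current)
        linarith

theorem le_one_of_minAverageCutAtLeast [Nontrivial V] {P : Protocol V (ZMod 2) k s} {C : ℝ}
    (hcut : MinAverageCutAtLeast P A Δ C) : C ≤ 1 := by
  obtain ⟨v, w, hvw⟩ := exists_pair_ne V
  obtain ⟨h, hh⟩ := (run P A (0 + Δ - 1)).support_nonempty
  refine (hcut {v} (Finset.singleton_nonempty v) ?_ 0 h hh).trans ?_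
  · intro he
    exact hvw (Finset.mem_singleton.1 (he ▸ Finset.mem_univ w)).symm
  · refine div_le_one_of_le₀ ?_ (Nat.cast_nonneg _)
    refine (Finset.sum_le_sum fun j _ => cutWeight_le_one _ _).trans ?_
    simp

/-- Some node has only knowledge in the kernel of `φ`. -/
def Stuck (src : Fin k → Set V) (φ : Module.Dual (ZMod 2) (Packet (ZMod 2) k))
    (σ : State V (ZMod 2) k s) : Prop :=
  ∃ v, knowledge src σ v ≤ LinearMap.ker φ

/-- Active packets lie in the knowledge, so a node whose knowledge is in the kernel is uninformed.
Together with nonemptiness, this makes the cut hypothesis applicable to the informed set. -/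
theorem Stuck.informed_ne_univ {t : ℕ} {h : History V (ZMod 2) k s}
    (hh : h ∈ (run (fmRLNC var src) A t).support) (hst : Stuck src φ h.current) :
    informed src φ h.current ≠ Finset.univ := by
  obtain ⟨v, hv⟩ := hst
  intro he
  obtain ⟨x, hx, hx'⟩ := mem_informed.1 (he ▸ Finset.mem_univ v : v ∈ informed src φ h.current)
  exact hx' (hv (activeSpan_le_knowledge hh v hx))

theorem exposure_window {C : ℝ} (hC : C ≤ 1) (hΔ : 1 ≤ Δ)
    (hcut : MinAverageCutAtLeast (fmRLNC var src) A Δ C) (hsrc : ∀ i, (src i).Nonempty)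
    (hφ : φ ≠ 0) {t : ℕ} {h : History V (ZMod 2) k s}
    (hh : h ∈ (run (fmRLNC var src) A (t + Δ)).support) (hst : Stuck src φ h.current) :
    exposure A src φ Δ (h.drop Δ) + Δ * C ≤ exposure A src φ Δ h := by
  have hΔ0 : (0 : ℝ) < Δ := by exact_mod_cast hΔ
  have hlen := length_of_mem_support_run hh
  rcases exposure_drop (A := A) (src := src) (φ := φ) (Δ := Δ) h Δ (by omega) with h1 | ⟨-, h2⟩
  · nlinarith
  -- The window in the cut hypothesis is indexed by the history before its last round, which is the
  -- tail of `h`.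
  · obtain ⟨h', hh', σ, -, rfl⟩ := mem_support_run_succ.1
      (show h ∈ (run (fmRLNC var src) A ((t + Δ - 1) + 1)).support by
        rwa [Nat.sub_add_cancel (by omega)])
    have := hcut _ (informed_nonempty hsrc hφ) (hst.informed_ne_univ hh) t h' hh'
    rw [le_div_iff₀ hΔ0] at this
    rw [h2]
    simp only [List.drop_succ_cons]
    linarith

theorem exposure_ge {C : ℝ} (hC : C ≤ 1) (hΔ : 1 ≤ Δ)
    (hcut : MinAverageCutAtLeast (fmRLNC var src) A Δ C) (hsrc : ∀ i, (src i).Nonempty)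
    (hφ : φ ≠ 0) (m r : ℕ) {h : History V (ZMod 2) k s}
    (hh : h ∈ (run (fmRLNC var src) A (r + m * Δ)).support) (hst : Stuck src φ h.current) :
    m * (Δ * C) ≤ exposure A src φ Δ h := by
  induction m generalizing h with
  | zero => simpa using exposure_nonneg h
  | succ m ih =>
    have hh' : h ∈ (run (fmRLNC var src) A ((r + m * Δ) + Δ)).support := by
      rwa [Nat.succ_mul, ← add_assoc] at hh
    -- Knowledge only grows, so a node that is stuck now was stuck at all earlier times.
    have hst' : Stuck src φ (History.current (h.drop Δ)) := by
      obtain ⟨v, hv⟩ := hst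
      exact ⟨v, (knowledge_drop_le hh' v).trans hv⟩
    have h1 := ih (drop_mem_support_run hh') hst'
    have h2 := exposure_window hC hΔ hcut hsrc hφ hh' hst
    push_cast
    linarith

end Exposure

/-! ### The upper bound -/

section UpperBound

variable {k s : ℕ} {src : Fin k → Set (Fin k)} {var : Variant}
  {A : Adversary (Fin k) (ZMod 2) k s} {Δ : ℕ}

theorem toOuterMeasure_stuck_le {C : ℝ} (hk : 2 ≤ k) (hs : 1 ≤ s) (hC0 : 0 < C) (hΔ : 1 ≤ Δ)
    (hδ : 2 * Real.exp (Δ / 4) * (1 / 2) ^ s ≤ C / 32)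
    (hcut : MinAverageCutAtLeast (fmRLNC var src) A Δ C) (hsrc : ∀ i, (src i).Nonempty)
    {φ : Module.Dual (ZMod 2) (Packet (ZMod 2) k)} (hφ : φ ≠ 0) {T : ℕ}
    (hT : (4 * Δ + 96 * Real.log 2) * (k / C) ≤ T) :
    (run (fmRLNC var src) A T).toOuterMeasure {h | Stuck src φ h.current} ≤ (1 / 4) ^ k := by
  have : Nontrivial (Fin k) := Fin.nontrivial_iff_two_le.2 hk
  have hC := le_one_of_minAverageCutAtLeast hcut
  have hlog := Real.log_pos one_lt_two
  have hΔ0 : (1 : ℝ) ≤ Δ := by exact_mod_cast hΔ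
  have hk1 : (1 : ℝ) ≤ k := by exact_mod_cast (by omega : 1 ≤ k)
  have hTC : (4 * Δ + 96 * Real.log 2) * k ≤ T * C := by
    rwa [← mul_div_assoc, div_le_iff₀ hC0] at hT
  have hTΔ : 2 * (Δ : ℝ) ≤ T := by
    have h1 : (T : ℝ) * C ≤ T := mul_le_of_le_one_right (Nat.cast_nonneg _) hC
    nlinarith
  -- As `T ≥ 2 * Δ`, the incomplete window is at most half of the time.
  have hmod : (T : ℝ) ≤ 2 * ((T / Δ : ℕ) * Δ) := by
    have h1 : (T : ℝ) = (T % Δ : ℕ) + (T / Δ : ℕ) * Δ := by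
      exact_mod_cast (Nat.mod_add_div' T Δ).symm
    have h2 : ((T % Δ : ℕ) : ℝ) ≤ Δ := by exact_mod_cast (Nat.mod_lt T hΔ).le
    linarith
  have hmarkov := mul_toOuterMeasure_le_expect (run (fmRLNC var src) A T)
    {h | Stuck src φ h.current} (4 ^ k) (potential A src φ Δ) fun h hh hst => by
      have hexp := exposure_ge hC hΔ hcut hsrc hφ (T / Δ) (T % Δ)
        (by rwa [Nat.mod_add_div'] : h ∈ (run (fmRLNC var src) A (T % Δ + T / Δ * Δ)).support) hst
      have hcard : ((informed src φ h.current).card : ℝ) ≤ k := by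
        exact_mod_cast (Finset.card_le_univ _).trans_eq (Fintype.card_fin k)
      have h4 : (4 : ℝ≥0∞) ^ k = ENNReal.ofReal (Real.exp (k * (2 * Real.log 2))) := by
        rw [Real.exp_nat_mul, two_mul, Real.exp_add, Real.exp_log two_pos,
          ENNReal.ofReal_pow (by norm_num)]
        norm_num
      rw [h4, potential, length_of_mem_support_run hh]
      refine ENNReal.ofReal_le_ofReal (Real.exp_le_exp.2 ?_)
      have e1 : (T : ℝ) * C ≤ 2 * exposure A src φ Δ h := by
        have := mul_le_mul_of_nonneg_right hmod hC0.le
        linarith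
      have e2 : ((Δ : ℝ) / 8 + Real.log 2) * (informed src φ h.current).card ≤
          ((Δ : ℝ) / 8 + Real.log 2) * k := by gcongr
      have e3 : 2 * Real.exp (Δ / 4) * (1 / 2) ^ s * T ≤ C / 32 * T := by gcongr
      -- The exponent is at least `TC/16 - (Δ/8 + log 2)k - TC/32`, and the choice of `T` gives
      -- `TC/32 ≥ (Δ/8 + 3 log 2)k`, leaving `2k log 2`.
      linarith
  have h := hmarkov.trans (expect_run_potential_le hs T)
  have h4 : ((4 : ℝ≥0∞) ^ k) ≠ 0 := by simp
  rw [one_div, ← ENNReal.inv_pow, ← one_div]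
  rwa [ENNReal.le_div_iff_mul_le (Or.inl h4) (Or.inl (by finiteness)), mul_comm]

theorem exists_stuck_of_not_allDecoded {σ : State (Fin k) (ZMod 2) k s}
    (h : ¬ AllDecoded src σ) :
    ∃ φ : Module.Dual (ZMod 2) (Packet (ZMod 2) k), φ ≠ 0 ∧ Stuck src φ σ := by
  rw [AllDecoded, not_forall] at h
  obtain ⟨v, hv⟩ := h
  obtain ⟨φ, hφ, hle⟩ := Submodule.exists_le_ker_of_lt_top _ (lt_top_iff_ne_top.2 hv)
  exact ⟨φ, hφ, v, hle⟩

theorem one_sub_le_successProb {T : ℕ}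
    (h : ∀ φ : Module.Dual (ZMod 2) (Packet (ZMod 2) k), φ ≠ 0 →
      (run (fmRLNC var src) A T).toOuterMeasure {h | Stuck src φ h.current} ≤ (1 / 4) ^ k) :
    1 - (1 / 2 : ℝ≥0∞) ^ k ≤ successProb (fmRLNC var src) A src T := by
  refine le_trans (tsub_le_tsub_left ?_ 1) (one_sub_toOuterMeasure_compl_le _ _)
  have : Finite (Module.Dual (ZMod 2) (Packet (ZMod 2) k)) := Module.finite_of_finite (ZMod 2)
  let _ : Fintype (Module.Dual (ZMod 2) (Packet (ZMod 2) k)) := Fintype.ofFinite _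
  have hcard : Fintype.card (Module.Dual (ZMod 2) (Packet (ZMod 2) k)) = 2 ^ k := by
    rw [Module.card_eq_pow_finrank (K := ZMod 2), Subspace.dual_finrank_eq]
    simp
  calc (run (fmRLNC var src) A T).toOuterMeasure {h | AllDecoded src h.current}ᶜ
      ≤ (run (fmRLNC var src) A T).toOuterMeasure
          (⋃ φ : Module.Dual (ZMod 2) (Packet (ZMod 2) k),
            -- The condition `φ ≠ 0` stays inside the event, so that the zero functional contributes
            -- the empty set to the union bound.
            {h | φ ≠ 0 ∧ Stuck src φ h.current}) := by
        refine MeasureTheory.measure_mono fun h hh => ?_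
        obtain ⟨φ, hφ⟩ := exists_stuck_of_not_allDecoded hh
        exact Set.mem_iUnion.2 ⟨φ, hφ⟩
    _ ≤ ∑ φ, (run (fmRLNC var src) A T).toOuterMeasure {h | φ ≠ 0 ∧ Stuck src φ h.current} :=
        MeasureTheory.measure_iUnion_fintype_le _ _
    _ ≤ ∑ _φ : Module.Dual (ZMod 2) (Packet (ZMod 2) k), (1 / 4 : ℝ≥0∞) ^ k := by
        refine Finset.sum_le_sum fun φ _ => ?_
        by_cases hφ : φ = 0
        · simp [hφ]
        · simpa [hφ] using h φ hφ
    _ = (2 * (1 / 4)) ^ k := by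
        rw [Finset.sum_const, Finset.card_univ, hcard, nsmul_eq_mul, mul_pow]
        push_cast
        rfl
    _ = (1 / 2) ^ k := by
        congr 1
        rw [← ENNReal.toReal_eq_toReal_iff' (by finiteness) (by finiteness)]
        simp
        norm_num

theorem not_stuck_of_subsingleton {φ : Module.Dual (ZMod 2) (Packet (ZMod 2) k)}
    (hk : Subsingleton (Fin k)) (hsrc : ∀ i, (src i).Nonempty) (hφ : φ ≠ 0) {T : ℕ}
    {h : History (Fin k) (ZMod 2) k s} (hh : h ∈ (run (fmRLNC var src) A T).support) :
    ¬ Stuck src φ h.current := fun hst =>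
  hst.informed_ne_univ hh <| by
    obtain ⟨v, hv⟩ := informed_nonempty (σ := h.current) hsrc hφ
    ext w
    simpa [Subsingleton.elim w v] using hv

/-- With logarithmic memory, the probability to forget is small compared to the cut. -/
theorem forgetting_le {n s : ℕ} {a C : ℝ} (hn : 2 ≤ n) (ha : 1 ≤ a) (hC : (n : ℝ) ^ (-a) ≤ C)
    (hs : (1 + (Real.log 64 + Δ / 4) / Real.log 2) / Real.log 2 * a * Real.log n ≤ s) :
    2 * Real.exp (Δ / 4) * (1 / 2) ^ s ≤ C / 32 := by
  have hlog := Real.log_pos one_lt_two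
  have hn0 : (0 : ℝ) < n := by exact_mod_cast (by omega : 0 < n)
  have hlogn : Real.log 2 ≤ Real.log n := Real.log_le_log two_pos (by exact_mod_cast hn)
  have h64 : 0 ≤ Real.log 64 := Real.log_nonneg (by norm_num)
  -- In the first factor, the summand `1` yields `n ^ (-a) ≤ C`, and the other one absorbs `64 * exp
  -- (Δ / 4)` because `a * log n ≥ log 2`.
  have h1 : (1 + (Real.log 64 + Δ / 4) / Real.log 2) * (a * Real.log n) ≤ s * Real.log 2 := by
    rw [div_mul_eq_mul_div, div_mul_eq_mul_div, div_le_iff₀ hlog] at hs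
    linarith
  have h2 : Real.log 2 ≤ a * Real.log n := by nlinarith
  have h3 : Real.log 64 + Δ / 4 ≤ (Real.log 64 + Δ / 4) / Real.log 2 * (a * Real.log n) := by
    rw [div_mul_eq_mul_div, le_div_iff₀ hlog]
    gcongr
  have h4 : (1 / 2 : ℝ) ^ s = Real.exp (-(s * Real.log 2)) := by
    rw [Real.exp_neg, Real.exp_nat_mul, Real.exp_log two_pos, one_div, inv_pow]
  have h5 : (n : ℝ) ^ (-a) = Real.exp (-(a * Real.log n)) := by
    rw [Real.rpow_def_of_pos hn0]
    ring_nf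
  have h6 : 64 * (Real.exp (Δ / 4) * (1 / 2) ^ s) ≤ (n : ℝ) ^ (-a) := by
    rw [h4, h5, ← Real.exp_log (by norm_num : (0 : ℝ) < 64), ← Real.exp_add, ← Real.exp_add]
    refine Real.exp_le_exp.2 ?_
    linarith
  linarith

end UpperBound

/-! ### The lower bound -/

section LowerBound

variable {V F : Type} [Field F] {k s : ℕ}

theorem le_length_inbox_of_allDecoded {src : Fin k → Set V} {σ : State V F k s} {v : V}
    (hv : ∀ i, v ∉ src i) (h : AllDecoded src σ) : k ≤ (σ.inbox v).length := by
  classical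
  have h1 : (sourcePackets src v ∪ {x | x ∈ σ.inbox v} : Set (Packet F k)) =
      ((σ.inbox v).toFinset : Set (Packet F k)) := by
    ext x
    simp [sourcePackets, hv]
  have h2 := h v
  rw [h1] at h2
  have h3 := finrank_span_finset_le_card (R := F) (σ.inbox v).toFinset
  rw [Set.finrank, h2, finrank_top, Module.finrank_fin_fun] at h3
  exact h3.trans (List.toFinset_card_le _)

variable [DecidableEq V]

/-- A round adds at most one packet to the inbox of `v`, and only if the sampled pair ends at `v`;
what the protocol sends is irrelevant. -/
theorem expect_length_inbox_le (P : Protocol V F k s) (A : Adversary V F k s) (v : V) (c : ℝ≥0∞)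
    (hA : ∀ h, expect (A h) (fun e => if e.1 ≠ e.2 ∧ e.2 = v then 1 else 0) ≤ c) (T : ℕ) :
    expect (run P A T) (fun h => ((h.current.inbox v).length : ℝ≥0∞)) ≤ T * c := by
  induction T with
  | zero => simp [run, expect_pure, History.current, State.init]
  | succ T ih =>
    simp only [run, expect_bind, expect_map]
    have hstep : ∀ h : History V F k s,
        expect (step P A h) (fun σ => ((History.current (σ :: h)).inbox v).length) ≤
          ((h.current.inbox v).length : ℝ≥0∞) + c := by
      intro h
      rw [step, expect_bind]
      refine (expect_mono (g := fun e => ((h.current.inbox v).length : ℝ≥0∞) +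
        if e.1 ≠ e.2 ∧ e.2 = v then 1 else 0) fun e _ => ?_).trans ?_
      · by_cases he : e.1 = e.2
        · simp [he, expect_pure, History.current]
        · rw [if_neg he, expect_map]
          refine expect_le_const fun x _ => ?_
          by_cases hv : e.2 = v
          · subst hv
            simp [History.current, he]
          · simp [History.current, hv, Function.update_of_ne (Ne.symm hv)]
      · rw [expect_add, expect_const]
        gcongr
        exact hA h
    refine (expect_mono fun h _ => hstep h).trans ?_
    rw [expect_add, expect_const]
    push_cast
    rw [add_mul, one_mul]
    gcongr

/-- On the directed cycle every edge has probability `C`; with the remaining probability nothing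
happens. -/
noncomputable def cyclePMF (n : ℕ) [NeZero n] (C : ℝ≥0∞) (hC : n * C ≤ 1) :
    PMF (Fin n × Fin n) :=
  PMF.ofFintype (fun e => (if e.2 = e.1 + 1 then C else 0) + if e = (0, 0) then 1 - n * C else 0) <| by
    rw [Finset.sum_add_distrib, Finset.sum_ite_eq' Finset.univ, if_pos (Finset.mem_univ _),
      Fintype.sum_prod_type]
    simp [add_tsub_cancel_of_le hC]

theorem le_cutWeight_cyclePMF {n : ℕ} [NeZero n] {C : ℝ} (hC : n * ENNReal.ofReal C ≤ 1)
    {S : Finset (Fin n)} (hne : S.Nonempty) (huniv : S ≠ Finset.univ) :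
    C ≤ cutWeight (cyclePMF n (ENNReal.ofReal C) hC) S := by
  -- A nonempty set closed under `u ↦ u + 1` contains the whole cycle, so a proper one is left by
  -- some edge.
  obtain ⟨u, hu, hu'⟩ : ∃ u ∈ S, u + 1 ∉ S := by
    by_contra! hS
    obtain ⟨v, hv⟩ := hne
    have hadd : ∀ j : ℕ, v + Fin.ofNat n j ∈ S := by
      intro j
      induction j with
      | zero => simpa using hv
      | succ j ih =>
        have := hS _ ih
        rwa [add_assoc, show Fin.ofNat n j + 1 = Fin.ofNat n (j + 1) by
          ext; simp [Fin.val_add]] at this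
    refine huniv (Finset.eq_univ_of_forall fun w => ?_)
    have := hadd (w - v).val
    rwa [Fin.ofNat_val_eq_self, add_sub_cancel] at this
  have h1 : C ≤ (cyclePMF n (ENNReal.ofReal C) hC (u, u + 1)).toReal := by
    rw [← ENNReal.ofReal_le_iff_le_toReal (PMF.apply_ne_top _ _)]
    simp [cyclePMF]
  refine h1.trans (le_trans ?_ (Finset.single_le_sum (f := fun u => ∑ v ∈ Sᶜ,
    (cyclePMF n (ENNReal.ofReal C) hC (u, v)).toReal)
    (fun _ _ => Finset.sum_nonneg fun _ _ => ENNReal.toReal_nonneg) hu))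
  exact Finset.single_le_sum (f := fun v => (cyclePMF n (ENNReal.ofReal C) hC (u, v)).toReal)
    (fun _ _ => ENNReal.toReal_nonneg) (Finset.mem_compl.2 hu')

theorem minAverageCutAtLeast_cyclePMF {n : ℕ} [NeZero n] {C : ℝ}
    (hC : n * ENNReal.ofReal C ≤ 1) (P : Protocol (Fin n) F k s) {Δ : ℕ} (hΔ : 1 ≤ Δ) :
    MinAverageCutAtLeast P (fun _ => cyclePMF n (ENNReal.ofReal C) hC) Δ C := by
  intro S hne huniv t h _
  have hΔ0 : (0 : ℝ) < Δ := by exact_mod_cast hΔ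
  rw [Finset.sum_const, Finset.card_range, nsmul_eq_mul, mul_div_cancel_left₀ _ hΔ0.ne']
  exact le_cutWeight_cyclePMF hC hne huniv

theorem expect_cyclePMF_le {n : ℕ} [NeZero n] (hn : 2 ≤ n) {C : ℝ≥0∞} (hC : n * C ≤ 1) :
    expect (cyclePMF n C hC) (fun e => if e.1 ≠ e.2 ∧ e.2 = 1 then 1 else 0) ≤ C := by
  have h10 : (1 : Fin n) ≠ 0 := by
    simp [Fin.ext_iff, Nat.mod_eq_of_lt hn]
  -- The edge `(0, 1)` is the only pair of positive probability ending at node `1`; the idle mass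
  -- sits at `(0, 0)`.
  rw [expect, tsum_eq_single (0, 1)]
  · simp only [cyclePMF, PMF.ofFintype_apply]
    simp [h10, h10.symm]
  · rintro ⟨u, v⟩ huv
    by_cases hv : v = 1
    · subst hv
      have hu : u ≠ 0 := fun h => huv (by rw [h])
      simp [cyclePMF, h10, hu]
    · simp [hv]

end LowerBound

end NetCoding

theorem mainTheorem3 :
    -- upper bound: time `O(n / C)` with probability at least `1 - 2 ^ (-n)`
    (∀ Δ : ℕ, 1 ≤ Δ → ∃ K c : ℝ, 0 < K ∧ 0 < c ∧
      ∀ (n s : ℕ) (a C : ℝ), 1 ≤ n → 1 ≤ a → 0 < C → (n : ℝ) ^ (-a) ≤ C →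
        c * a * Real.log n ≤ s →
        ∀ (var : NetCoding.Variant) (src : Fin n → Set (Fin n)), (∀ i, (src i).Nonempty) →
        ∀ A : NetCoding.Adversary (Fin n) (ZMod 2) n s,
          NetCoding.MinAverageCutAtLeast (NetCoding.fmRLNC var src) A Δ C →
          ∀ T : ℕ, K * (n / C) ≤ T →
            1 - (1 / 2 : ENNReal) ^ n ≤
              NetCoding.successProb (NetCoding.fmRLNC var src) A src T) ∧
    -- order optimality: on some networks no protocol needs fewer than `n / (2 C)` rounds
    (∀ (n : ℕ) (C : ℝ), 2 ≤ n → 0 < C → C ≤ 1 / n →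
      ∃ (src : Fin n → Set (Fin n)) (p : PMF (Fin n × Fin n)), (∀ i, (src i).Nonempty) ∧
        ∀ (s : ℕ) (P : NetCoding.Protocol (Fin n) (ZMod 2) n s),
          (∀ Δ : ℕ, 1 ≤ Δ → NetCoding.MinAverageCutAtLeast P (fun _ => p) Δ C) ∧
          ∀ T : ℕ, (T : ℝ) ≤ n / (2 * C) →
            NetCoding.successProb P (fun _ => p) src T ≤ 1 / 2) := by
  constructor
  · intro Δ hΔ
    have hlog := Real.log_pos one_lt_two
    have h64 : 0 ≤ Real.log 64 := Real.log_nonneg (by norm_num)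
    refine ⟨4 * Δ + 96 * Real.log 2, (1 + (Real.log 64 + Δ / 4) / Real.log 2) / Real.log 2,
      by positivity, by positivity, ?_⟩
    intro n s a C hn ha hC0 hC hs var src hsrc A hcut T hT
    refine NetCoding.one_sub_le_successProb fun φ hφ => ?_
    -- For `n = 1` the hypotheses give neither `1 ≤ s` (as `log n = 0`) nor `C ≤ 1` (there are no
    -- cuts), but the only node is a source and is always informed.
    rcases hn.lt_or_eq with hn2 | rfl
    · have hn2 : 2 ≤ n := hn2
      have hs1 : 1 ≤ s := by
        have hlogn : 0 < Real.log n := Real.log_pos (by exact_mod_cast hn2)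
        have : (0 : ℝ) < s := lt_of_lt_of_le (by positivity) hs
        exact_mod_cast this
      exact NetCoding.toOuterMeasure_stuck_le hn2 hs1 hC0 hΔ
        (NetCoding.forgetting_le hn2 ha hC hs) hcut hsrc hφ hT
    · refine le_of_eq_of_le ((PMF.toOuterMeasure_apply_eq_zero_iff _ _).2 ?_) zero_le
      exact Set.disjoint_left.2 fun h hh =>
        NetCoding.not_stuck_of_subsingleton inferInstance hsrc hφ hh
  · intro n C hn hC0 hC
    have : NeZero n := ⟨by omega⟩
    have hn0 : (0 : ℝ) < n := by exact_mod_cast (by omega : 0 < n)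
    have hnC : (n : ENNReal) * ENNReal.ofReal C ≤ 1 := by
      rw [← ENNReal.ofReal_natCast, ← ENNReal.ofReal_mul hn0.le, ENNReal.ofReal_le_one, mul_comm]
      rwa [le_div_iff₀ hn0] at hC
    have h10 : (1 : Fin n) ≠ 0 := by
      simp [Fin.ext_iff, Nat.mod_eq_of_lt hn]
    refine ⟨fun _ => {0}, NetCoding.cyclePMF n (ENNReal.ofReal C) hnC,
      fun _ => Set.singleton_nonempty _, fun s P =>
        ⟨fun Δ hΔ => NetCoding.minAverageCutAtLeast_cyclePMF hnC P hΔ, fun T hT => ?_⟩⟩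
    have h1 := NetCoding.mul_toOuterMeasure_le_expect
      (NetCoding.run P (fun _ => NetCoding.cyclePMF n (ENNReal.ofReal C) hnC) T)
      {h | NetCoding.AllDecoded (fun _ => {0}) h.current} n
      (fun h => ((h.current.inbox 1).length : ENNReal)) fun h _ hd => by
        exact_mod_cast NetCoding.le_length_inbox_of_allDecoded (v := 1) (fun i => h10) hd
    have h2 := h1.trans (NetCoding.expect_length_inbox_le P _ 1 (ENNReal.ofReal C)
      (fun _ => NetCoding.expect_cyclePMF_le hn hnC) T)
    have h3 : (T : ENNReal) * ENNReal.ofReal C ≤ n * (1 / 2) := by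
      rw [← ENNReal.ofReal_natCast T, ← ENNReal.ofReal_natCast n,
        ← ENNReal.ofReal_mul (Nat.cast_nonneg _), show (1 / 2 : ENNReal) = ENNReal.ofReal (1 / 2) by
          rw [ENNReal.ofReal_div_of_pos two_pos, ENNReal.ofReal_one, ENNReal.ofReal_ofNat],
        ← ENNReal.ofReal_mul hn0.le]
      refine ENNReal.ofReal_le_ofReal ?_
      rw [le_div_iff₀ (by positivity)] at hT
      linarith
    exact (ENNReal.mul_le_mul_iff_right (by exact_mod_cast NeZero.ne n)
      (ENNReal.natCast_ne_top n)).1 (h2.trans h3)
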